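/- Let $X$ be a Hilbert $C^*$-module over a (not necessarily unital) $C^*$-algebra $A$. For a densely defined $A$-linear operator $T : \mathrm{Dom}(T) \to X$, $\mathrm{Dom}(T) \subseteq X$, the adjoint $T^*$ has as domain the set of all $\eta \in X$ for which there is a (necessarily unique) $\zeta \in X$ with $\langle T\xi,\eta\rangle = \langle \xi,\zeta\rangle$ for all $\xi \in \mathrm{Dom}(T)$, and $T^*\eta := \zeta$. The operator $T$ is called selfadjoint if $T = T^*$ (including equality of domains), and regular if it is closed and densely defined, $T^*$ is densely defined, and $1 + T^*T$ has dense range, where $\mathrm{Dom}(T^*T) = \{\xi \in \mathrm{Dom}(T) : T\xi \in \mathrm{Dom}(T^*)\}$. Let $D : \mathrm{Dom}(D) \to X$ be a selfadjoint and regular operator on $X$, and let $x : X \to X$ be a bounded adjointable selfadjoint operator such that $x\xi \in \mathrm{Dom}(D)$ for all $\xi \in \mathrm{Dom}(D)$ and such that the commutator $[D,x] = Dx - xD : \mathrm{Dom}(D) \to X$ is bounded. Denote by $\delta(x) : X \to X$ the unique bounded extension of $[D,x]$. Then the operator $Dx$ with domain $\mathrm{Dom}(Dx) = \{\xi \in X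 : x\xi \in \mathrm{Dom}(D)\}$ is closed and regular, and its adjoint is $(Dx)^* = Dx - \delta(x)$, with domain $\mathrm{Dom}((Dx)^*) = \mathrm{Dom}(Dx)$. -/

import Mathlib

namespace HilbertModule

section

variable (A : Type*) {X : Type*} [NonUnitalCStarAlgebra A] [PartialOrder A]
  [NormedAddCommGroup X] [NormedSpace ℂ X] [SMul A X] [CStarModule A X]

/-- The graph of the adjoint of an unbounded operator `T` on a Hilbert C⋆-module:
all pairs `(η, ζ)` with `⟪T ξ, η⟫ = ⟪ξ, ζ⟫` for every `ξ` in the domain of `T`. -/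
def adjointGraph (T : X →ₗ.[ℂ] X) : Submodule ℂ (X × X) where
  carrier := {p | ∀ ξ : T.domain, inner A (T ξ) p.1 = inner A (ξ : X) p.2}
  zero_mem' := by
    intro ξ
    simp
  add_mem' := by
    intro p q hp hq ξ
    simp [hp ξ, hq ξ]
  smul_mem' := by
    intro c p hp ξ
    simp [hp ξ]

/-- The adjoint of a densely defined unbounded operator `T`. Its domain consists of all `η`
for which there is a `ζ` with `⟪T ξ, η⟫ = ⟪ξ, ζ⟫` for every `ξ` in the domain of `T`; this `ζ`
is then unique, and it is the value at `η`. -/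
noncomputable def adjoint (T : X →ₗ.[ℂ] X) : X →ₗ.[ℂ] X :=
  (adjointGraph A T).toLinearPMap

/-- For a densely defined operator the adjoint has the expected graph. -/
theorem graph_adjoint [StarOrderedRing A] {T : X →ₗ.[ℂ] X} (hT : Dense (T.domain : Set X)) :
    (adjoint A T).graph = adjointGraph A T := by
  refine Submodule.toLinearPMap_graph_eq _ ?_
  rintro ⟨η, ζ⟩ h h0
  have h0' : η = 0 := h0
  subst h0'
  have h1 : ∀ ξ : X, inner A ξ ζ = 0 := by
    intro ξ
    refine hT.induction (P := fun ξ => inner A ξ ζ = 0) ?_ ?_ ξ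
    · intro ξ hξ
      have := h ⟨ξ, hξ⟩
      simpa using this.symm
    · exact isClosed_eq (by fun_prop) continuous_const
  exact CStarModule.inner_self.1 (h1 ζ)

/-- An unbounded operator is `A`-linear: its domain is invariant under the action of `A`, and the
operator commutes with this action. -/
def IsModuleMap (T : X →ₗ.[ℂ] X) : Prop :=
  ∀ (a : A) (ξ : T.domain), ∃ h : a • (ξ : X) ∈ T.domain, T ⟨a • (ξ : X), h⟩ = a • T ξ

/-- A densely defined unbounded operator is selfadjoint if it is equal to its adjoint,
with equality of domains. -/
structure IsSelfAdjoint (T : X →ₗ.[ℂ] X) : Prop where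
  dense_domain : Dense (T.domain : Set X)
  adjoint_eq : adjoint A T = T

/-- The range of `1 + T⋆T`, where `T⋆T` has the domain
`{ξ ∈ Dom T | T ξ ∈ Dom T⋆}`. -/
def rangeOneAddAdjointMul (T : X →ₗ.[ℂ] X) : Set X :=
  {ζ | ∃ (ξ : T.domain) (h : T ξ ∈ (adjoint A T).domain),
    (ξ : X) + adjoint A T ⟨T ξ, h⟩ = ζ}

/-- A regular operator on a Hilbert C⋆-module: a closed, densely defined, `A`-linear operator `T`
whose adjoint is densely defined and for which `1 + T⋆T` has dense range. -/
structure IsRegular (T : X →ₗ.[ℂ] X) : Prop where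
  isModuleMap : IsModuleMap A T
  isClosed : T.IsClosed
  dense_domain : Dense (T.domain : Set X)
  dense_domain_adjoint : Dense ((adjoint A T).domain : Set X)
  dense_range : Dense (rangeOneAddAdjointMul A T)

end

section

variable {X : Type*} [NormedAddCommGroup X] [NormedSpace ℂ X]

/-- The composition `D x` with the domain `{ξ | x ξ ∈ Dom D}`. -/
def mulBounded (D : X →ₗ.[ℂ] X) (x : X →L[ℂ] X) : X →ₗ.[ℂ] X where
  domain := D.domain.comap (x : X →ₗ[ℂ] X)
  toFun := D.toFun ∘ₗ (x : X →ₗ[ℂ] X).submoduleComap D.domain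

/-- The commutator `[D, x] = D x - x D` on `Dom D`, for `x` mapping `Dom D` to itself. -/
def commutator (D : X →ₗ.[ℂ] X) (x : X →L[ℂ] X) (hx : ∀ ξ ∈ D.domain, x ξ ∈ D.domain) :
    D.domain →ₗ[ℂ] X :=
  D.toFun ∘ₗ (x : X →ₗ[ℂ] X).restrict hx - (x : X →ₗ[ℂ] X) ∘ₗ D.toFun

theorem commutator_apply (D : X →ₗ.[ℂ] X) (x : X →L[ℂ] X)
    (hx : ∀ ξ ∈ D.domain, x ξ ∈ D.domain) (ξ : D.domain) :
    commutator D x hx ξ = D ⟨x ξ, hx ξ ξ.2⟩ - x (D ξ) := rfl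

variable [CompleteSpace X]

/-- The bounded extension `δ(x)` of the commutator `[D, x]` to the whole module (when `Dom D` is
dense and the commutator is bounded). -/
noncomputable def commutatorExt (D : X →ₗ.[ℂ] X) (x : X →L[ℂ] X)
    (hx : ∀ ξ ∈ D.domain, x ξ ∈ D.domain) : X →L[ℂ] X :=
  (commutator D x hx).extendOfNorm D.domain.subtype

theorem commutatorExt_apply {D : X →ₗ.[ℂ] X} (hD : Dense (D.domain : Set X)) {x : X →L[ℂ] X}
    (hx : ∀ ξ ∈ D.domain, x ξ ∈ D.domain)
    (hb : ∃ C : ℝ, ∀ ξ : D.domain, ‖commutator D x hx ξ‖ ≤ C * ‖(ξ : X)‖) (ξ : D.domain) :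
    commutatorExt D x hx ξ = D ⟨x ξ, hx ξ ξ.2⟩ - x (D ξ) :=
  LinearMap.extendOfNorm_eq (e := D.domain.subtype) hD.denseRange_val hb ξ

end

end HilbertModule

/-! Closed submodules of a Hilbert C⋆-module need not be complemented, so a trivial kernel of the
adjoint does not give dense range. Surjectivity is instead obtained from lower bounds, closed ranges
and Neumann series.

Write d = δ(x); it is skew-adjoint. The resolvents (1 + isD)⁻¹ commute with D x up to terms in d
(`apply_snd_add_mem`) and tend strongly to 1 as s → 0, so Dom D is a core for D x (`mem_closure`).
On Dom D one has D x = xD + d, and pairing gives both inclusions of (D x)⋆ = D x - d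
(`inner_mulGraph`, `mem_mulGraph_of_inner`); only the first needs the core.

For regularity, the imaginary part of ⟨ξ, (D x + iμ)ξ⟩ bounds D x + iμ from below once μ > ‖d‖, so
its range is closed. To see that the range is everything, add iηD²: the sum is surjective on Dom D²
(`surjective_regularized`), and its energy bounds η‖Dξ‖² independently of η. Solving with right-hand
side (1 + iD)w and applying (1 + iD)⁻¹ to the equation gives, for small η, a solution of (D x + iμ)p
= w up to an error of 3/4 ‖w‖ (`exists_norm_sub_le`), and Riesz's lemma finishes.

Hence (D x - d + iμ)(D x - iμ) is surjective. It differs from μ² + (D x)⋆D x by iμd, which is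
relatively small for large μ; one more perturbation lowers μ² to 1. -/

namespace HilbertModule

open Complex

/-! ### Perturbation and closed-range criteria in Banach spaces -/

section Perturbation

variable {E X : Type*} [AddCommGroup E] [Module ℂ E] [NormedAddCommGroup X] [NormedSpace ℂ X]
  [CompleteSpace X]

/-- A relatively bounded perturbation, with relative bound less than `1`, of a surjective linear
map into a Banach space is surjective. -/
theorem surjective_of_norm_sub_le {G H : E →ₗ[ℂ] X} (hG : Function.Surjective G) {θ : ℝ}
    (hθ : θ < 1) (h : ∀ p, ‖H p - G p‖ ≤ θ * ‖G p‖) : Function.Surjective H := by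
  obtain ⟨s, hs⟩ := G.exists_rightInverse_of_surjective (LinearMap.range_eq_top.2 hG)
  have hs' : ∀ z, G (s z) = z := fun z => LinearMap.congr_fun hs z
  -- The section s is merely linear, but (G - H) ∘ s is bounded by hypothesis, and H ∘ s = 1 - t is
  -- inverted by a Neumann series.
  let t : X →L[ℂ] X := ((G - H) ∘ₗ s).mkContinuous (max θ 0) (by
    intro z
    have h1 := h (s z)
    rw [hs', norm_sub_rev] at h1
    simp only [LinearMap.comp_apply, LinearMap.sub_apply, hs']
    exact h1.trans (by gcongr; exact le_max_left _ _))
  have ht : ‖t‖ < 1 :=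
    (LinearMap.mkContinuous_norm_le _ (le_max_right _ _) _).trans_lt (max_lt hθ one_pos)
  obtain ⟨u, hu⟩ := isUnit_one_sub_of_norm_lt_one ht
  intro y
  refine ⟨s ((↑u⁻¹ : X →L[ℂ] X) y), ?_⟩
  have h1 : (1 - t) ((↑u⁻¹ : X →L[ℂ] X) y) = y := by
    rw [← hu, ← mul_apply_eq_comp, Units.mul_inv, one_apply_eq_self]
  calc H (s ((↑u⁻¹ : X →L[ℂ] X) y)) = (1 - t) ((↑u⁻¹ : X →L[ℂ] X) y) := by
        simp [t, hs']
    _ = y := h1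

/-- For a closed graph that is bounded below by `k > 0` after a shift by `z`, the shifted operator
has closed range. -/
theorem isClosed_map_of_le {Γ : Submodule ℂ (X × X)} (hΓ : IsClosed (Γ : Set (X × X))) {z : ℂ}
    {k : ℝ} (hk : 0 < k) (h : ∀ p ∈ Γ, k * ‖p.1‖ ≤ ‖p.2 + z • p.1‖) :
    IsClosed (Γ.map (LinearMap.snd ℂ X X + z • LinearMap.fst ℂ X X) : Set X) := by
  have : CompleteSpace Γ := hΓ.completeSpace_coe
  let f : Γ →L[ℂ] X :=
    (ContinuousLinearMap.snd ℂ X X + z • ContinuousLinearMap.fst ℂ X X) ∘L Γ.subtypeL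
  have hf : ∀ p : Γ, ‖p‖ ≤ ((1 + (1 + ‖z‖) / k).toNNReal : ℝ) * ‖f p‖ := by
    intro p
    have h1 : k * ‖p.1.1‖ ≤ ‖f p‖ := h p.1 p.2
    have h2 : ‖p.1.2‖ ≤ ‖f p‖ + ‖z‖ * ‖p.1.1‖ := by
      have : p.1.2 = f p - z • p.1.1 := by simp [f]
      rw [this, ← norm_smul]
      exact norm_sub_le _ _
    have h3 : ‖p.1.1‖ ≤ ‖f p‖ / k := by rwa [le_div_iff₀' hk]
    rw [Real.coe_toNNReal _ (by positivity)]
    have h4 : (1 + (1 + ‖z‖) / k) * ‖f p‖ = ‖f p‖ + ‖f p‖ / k + ‖z‖ * (‖f p‖ / k) := by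
      field_simp
      ring
    have h5 : 0 ≤ ‖f p‖ / k := by positivity
    have h6 : ‖z‖ * ‖p.1.1‖ ≤ ‖z‖ * (‖f p‖ / k) := by gcongr
    have h7 : 0 ≤ ‖z‖ * (‖f p‖ / k) := by positivity
    have h8 := norm_nonneg (f p)
    change ‖p.1‖ ≤ _
    rw [Prod.norm_def, h4]
    exact max_le (by linarith) (by linarith)
  have h1 := (AddMonoidHomClass.antilipschitz_of_bound f hf).isClosed_range f.uniformContinuous
  convert h1 using 1
  ext y
  simp [f]

omit [CompleteSpace X] in
/-- A subspace that contains, for all `g` in a dense set, an element at distance at most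
`3 / 4 * ‖g‖` from `g` is everything if it is closed. -/
theorem mem_of_forall_dense_norm_sub_le {V : Submodule ℂ X} (hV : IsClosed (V : Set X)) {S : Set X}
    (hS : Dense S) (h : ∀ g ∈ S, ∃ v ∈ V, ‖v - g‖ ≤ 3 / 4 * ‖g‖) (y : X) : y ∈ V := by
  by_contra hy
  -- The constants clash: 1/20 + 3/4 * (1 + 1/20) < 9/10.
  obtain ⟨w, hw, hw'⟩ := riesz_lemma hV ⟨y, hy⟩ (r := 9 / 10) (by norm_num)
  have hw0 : 0 < ‖w‖ := norm_pos_iff.2 (by rintro rfl; exact hw V.zero_mem)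
  obtain ⟨g, hg, hgw⟩ := Metric.dense_iff.1 hS w (‖w‖ / 20) (by positivity)
  obtain ⟨v, hv, hvg⟩ := h g hgw
  rw [Metric.mem_ball, dist_eq_norm] at hg
  have h1 := hw' v hv
  have h2 : ‖w - v‖ ≤ ‖g - w‖ + ‖v - g‖ := by
    rw [show w - v = -(g - w) - (v - g) by abel, ← norm_neg (g - w)]
    exact norm_sub_le _ _
  have h3 : ‖g‖ ≤ ‖g - w‖ + ‖w‖ := by simpa using norm_add_le (g - w) w
  linarith

end Perturbation

/-! ### Norm estimates from A-valued inner products -/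

section Inner

variable {A X : Type*} [NonUnitalCStarAlgebra A] [PartialOrder A] [StarOrderedRing A]
  [NormedAddCommGroup X] [NormedSpace ℂ X] [SMul A X] [CStarModule A X]

variable (A) in
theorem norm_le_of_inner_self_le {a b : X} (h : inner A a a ≤ inner A b b) : ‖a‖ ≤ ‖b‖ := by
  rw [CStarModule.norm_eq_sqrt_norm_inner_self (A := A) a,
    CStarModule.norm_eq_sqrt_norm_inner_self (A := A) b]
  exact Real.sqrt_le_sqrt
    (CStarAlgebra.norm_le_norm_of_nonneg_of_le CStarModule.inner_self_nonneg h)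

/-- Since the norm is monotone on positive elements, either term can be extracted from an A-valued
energy. -/
theorem mul_sq_le_norm_smul_add {s t : ℝ} (hs : 0 ≤ s) (ht : 0 ≤ t) (a b : X) :
    s * ‖a‖ ^ 2 ≤ ‖s • inner A a a + t • inner A b b‖ := by
  have h1 : s * ‖a‖ ^ 2 = ‖s • inner A a a‖ := by
    rw [norm_smul, CStarModule.norm_sq_eq A, Real.norm_of_nonneg hs]
  rw [h1]
  refine CStarAlgebra.norm_le_norm_of_nonneg_of_le
    (smul_nonneg hs CStarModule.inner_self_nonneg) ?_
  exact le_add_of_nonneg_right (smul_nonneg ht CStarModule.inner_self_nonneg)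

/-- Energy estimate by taking imaginary parts and Cauchy–Schwarz. In the applications g is the image
of v, and e = d v records the failure of D x to be symmetric. -/
theorem norm_le_of_inner_sub_inner {s t : ℝ} {v w g e : X}
    (h : inner A v g - inner A g v =
      (2 * I) • (s • inner A v v + t • inner A w w) + inner A v e) :
    ‖s • inner A v v + t • inner A w w‖ ≤ ‖v‖ * (‖g‖ + ‖e‖) := by
  have h1 : (2 * I) • (s • inner A v v + t • inner A w w) =
      inner A v g - inner A g v - inner A v e := by rw [h]; abel
  have h2 := congrArg norm h1
  rw [norm_smul] at h2
  have h3 : ‖2 * I‖ = 2 := by simp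
  rw [h3] at h2
  have h4 := norm_sub_le (inner A v g - inner A g v) (inner A v e)
  have h5 := norm_sub_le (inner A v g) (inner A g v)
  have h6 := CStarModule.norm_inner_le (A := A) X (x := v) (y := g)
  have h7 := CStarModule.norm_inner_le (A := A) X (x := g) (y := v)
  have h8 := CStarModule.norm_inner_le (A := A) X (x := v) (y := e)
  have h9 : 0 ≤ ‖v‖ * ‖e‖ := by positivity
  nlinarith

end Inner

/-! ### Resolvents of a selfadjoint regular operator -/

/-- The graph of the square of an operator with graph `Γ`, with the intermediate value included. -/
def sqGraph {X : Type*} [AddCommGroup X] [Module ℂ X] (Γ : Submodule ℂ (X × X)) :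
    Submodule ℂ (X × X × X) where
  carrier := {p | (p.1, p.2.1) ∈ Γ ∧ p.2 ∈ Γ}
  zero_mem' := ⟨Γ.zero_mem, Γ.zero_mem⟩
  add_mem' := fun hp hq => ⟨Γ.add_mem hp.1 hq.1, Γ.add_mem hp.2 hq.2⟩
  smul_mem' := fun c _ hp => ⟨Γ.smul_mem c hp.1, Γ.smul_mem c hp.2⟩

/-- The operator `z + T²` on the domain of `T²`, where `T` has the graph `Γ`. -/
def addSq {X : Type*} [AddCommGroup X] [Module ℂ X] (Γ : Submodule ℂ (X × X)) (z : ℂ) :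
    sqGraph Γ →ₗ[ℂ] X :=
  (LinearMap.snd ℂ X X ∘ₗ LinearMap.snd ℂ X (X × X) + z • LinearMap.fst ℂ X (X × X)) ∘ₗ
    (sqGraph Γ).subtype

section

variable (A : Type*) {X : Type*} [NonUnitalCStarAlgebra A] [PartialOrder A]
  [NormedAddCommGroup X] [NormedSpace ℂ X] [SMul A X] [CStarModule A X]

/-- A submodule of `X × X` that is the graph of a selfadjoint operator. -/
structure IsSelfAdjointGraph (Γ : Submodule ℂ (X × X)) : Prop where
  symm : ∀ p ∈ Γ, ∀ q ∈ Γ, inner A p.2 q.1 = inner A p.1 q.2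
  maximal : ∀ q : X × X, (∀ p ∈ Γ, inner A p.2 q.1 = inner A p.1 q.2) → q ∈ Γ
  dense : Dense (Γ.map (LinearMap.fst ℂ X X) : Set X)

end

namespace IsSelfAdjointGraph

variable {A X : Type*} [NonUnitalCStarAlgebra A] [PartialOrder A] [StarOrderedRing A]
  [NormedAddCommGroup X] [NormedSpace ℂ X] [SMul A X] [CStarModule A X]
  {Γ : Submodule ℂ (X × X)}

theorem isClosed (hΓ : IsSelfAdjointGraph A Γ) : IsClosed (Γ : Set (X × X)) := by
  have : (Γ : Set (X × X)) = ⋂ p ∈ Γ, {q | inner A p.2 q.1 = inner A p.1 q.2} := by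
    ext q
    simp only [Set.mem_iInter]
    exact ⟨fun hq p hp => hΓ.symm p hp q hq, fun h => hΓ.maximal q h⟩
  rw [this]
  exact isClosed_biInter fun p _ => isClosed_eq (by fun_prop) (by fun_prop)

-- The cross terms cancel because D is symmetric. Dropping either remaining positive term shows that
-- (1 + isD)⁻¹ and isD(1 + isD)⁻¹ are contractive.
omit [StarOrderedRing A] in
theorem inner_add_smul_self (hΓ : IsSelfAdjointGraph A Γ) (s : ℝ) {p : X × X} (hp : p ∈ Γ) :
    inner A (p.1 + (s * I) • p.2) (p.1 + (s * I) • p.2) =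
      inner A p.1 p.1 + (s ^ 2) • inner A p.2 p.2 := by
  have h := hΓ.symm p hp p hp
  simp only [CStarModule.inner_add_left, CStarModule.inner_add_right,
    CStarModule.inner_smul_left_complex, CStarModule.inner_smul_right_complex, h]
  rw [← Complex.coe_smul]
  simp only [star_mul', RCLike.star_def, conj_ofReal, conj_I]
  push_cast
  match_scalars
  · ring
  · ring
  · linear_combination (-(s : ℂ) ^ 2) * I_sq

theorem norm_fst_le (hΓ : IsSelfAdjointGraph A Γ) (s : ℝ) {p : X × X} (hp : p ∈ Γ) :
    ‖p.1‖ ≤ ‖p.1 + (s * I) • p.2‖ := by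
  refine norm_le_of_inner_self_le A ?_
  rw [hΓ.inner_add_smul_self s hp]
  exact le_add_of_nonneg_right (smul_nonneg (by positivity) CStarModule.inner_self_nonneg)

theorem norm_smul_snd_le (hΓ : IsSelfAdjointGraph A Γ) (s : ℝ) {p : X × X} (hp : p ∈ Γ) :
    ‖(s * I) • p.2‖ ≤ ‖p.1 + (s * I) • p.2‖ := by
  refine norm_le_of_inner_self_le A ?_
  have : inner A ((s * I) • p.2) ((s * I) • p.2) = (s ^ 2) • inner A p.2 p.2 := by
    rw [← Complex.coe_smul]
    simp only [CStarModule.inner_smul_left_complex, CStarModule.inner_smul_right_complex,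
      star_mul', RCLike.star_def, conj_ofReal, conj_I]
    push_cast
    match_scalars
    linear_combination (-(s : ℂ) ^ 2) * I_sq
  rw [hΓ.inner_add_smul_self s hp, this]
  exact le_add_of_nonneg_left CStarModule.inner_self_nonneg

omit [StarOrderedRing A] in
theorem inner_fst_addSq (hΓ : IsSelfAdjointGraph A Γ) (s : ℝ) (p : sqGraph Γ) :
    inner A p.1.1 (addSq Γ s p) = s • inner A p.1.1 p.1.1 + (1 : ℝ) • inner A p.1.2.1 p.1.2.1 := by
  have h := hΓ.symm _ p.2.1 _ p.2.2
  simp only at h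
  simp [addSq, h, add_comm]

theorem mul_norm_fst_le_norm_addSq (hΓ : IsSelfAdjointGraph A Γ) {s : ℝ} (hs : 0 ≤ s)
    (p : sqGraph Γ) : s * ‖p.1.1‖ ≤ ‖addSq Γ s p‖ := by
  have h1 := mul_sq_le_norm_smul_add (A := A) hs zero_le_one p.1.1 p.1.2.1
  rw [← hΓ.inner_fst_addSq] at h1
  have h2 := h1.trans (CStarModule.norm_inner_le (A := A) X)
  rcases (norm_nonneg p.1.1).eq_or_lt with h | h
  · rw [← h]
    simp
  · rw [pow_two, ← mul_assoc, mul_comm] at h2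
    exact le_of_mul_le_mul_left h2 h

theorem norm_snd_sq_le (hΓ : IsSelfAdjointGraph A Γ) {s : ℝ} (hs : 0 ≤ s)
    (p : sqGraph Γ) : ‖p.1.2.1‖ ^ 2 ≤ ‖p.1.1‖ * ‖addSq Γ s p‖ := by
  have h1 := mul_sq_le_norm_smul_add (A := A) zero_le_one hs p.1.2.1 p.1.1
  rw [add_comm, ← hΓ.inner_fst_addSq, one_mul] at h1
  exact h1.trans (CStarModule.norm_inner_le (A := A) X)

variable [CompleteSpace X]

/-- The range of D + z is closed, as D + z is bounded below, and it contains the dense range of 1 +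
D² = (D + z)(D - z). -/
theorem exists_add_smul_of_dense (hΓ : IsSelfAdjointGraph A Γ) {z : ℂ} (hz : z * z = -1)
    (hz' : z = I ∨ z = -I) (h : Dense (Set.range (addSq Γ 1))) (y : X) :
    ∃ p ∈ Γ, p.2 + z • p.1 = y := by
  have hb : ∀ p ∈ Γ, 1 * ‖p.1‖ ≤ ‖p.2 + z • p.1‖ := by
    intro p hp
    have key : ∀ s : ℝ, (s : ℂ) * I * z = 1 → ‖((s : ℂ) * I)‖ = 1 →
        1 * ‖p.1‖ ≤ ‖p.2 + z • p.1‖ := by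
      intro s hs hs'
      have h1 := hΓ.norm_fst_le s hp
      have h2 : p.1 + (s * I) • p.2 = (s * I) • (p.2 + z • p.1) := by
        rw [smul_add, smul_smul, hs, one_smul, add_comm]
      rwa [h2, norm_smul, hs', one_mul, ← one_mul ‖p.1‖] at h1
    rcases hz' with rfl | rfl
    · exact key (-1) (by simp) (by simp)
    · exact key 1 (by simp) (by simp)
  have hc := isClosed_map_of_le hΓ.isClosed one_pos hb
  have hsub : Set.range (addSq Γ 1) ⊆
      (Γ.map (LinearMap.snd ℂ X X + z • LinearMap.fst ℂ X X) : Set X) := by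
    rintro _ ⟨p, rfl⟩
    refine ⟨p.1.2 - z • (p.1.1, p.1.2.1), Γ.sub_mem p.2.2 (Γ.smul_mem z p.2.1), ?_⟩
    simp only [addSq, LinearMap.add_apply, LinearMap.snd_apply, LinearMap.smul_apply,
      LinearMap.fst_apply, Prod.snd_sub, Prod.fst_sub, Prod.smul_snd, Prod.smul_fst,
      LinearMap.comp_apply, Submodule.subtype_apply]
    match_scalars
    · simp
    · ring
    · linear_combination -hz
  have hu := (h.mono hsub).closure_eq
  rw [hc.closure_eq] at hu
  have hy : y ∈ (Γ.map (LinearMap.snd ℂ X X + z • LinearMap.fst ℂ X X) : Set X) := by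
    rw [hu]
    trivial
  obtain ⟨p, hp, hpy⟩ := hy
  exact ⟨p, hp, by simpa using hpy⟩

theorem surjective_addSq_one (hΓ : IsSelfAdjointGraph A Γ) (h : Dense (Set.range (addSq Γ 1))) :
    Function.Surjective (addSq Γ 1) := by
  intro y
  obtain ⟨p, hp, rfl⟩ := hΓ.exists_add_smul_of_dense I_mul_I (.inl rfl) h y
  obtain ⟨q, hq, hqp⟩ := hΓ.exists_add_smul_of_dense (z := -I) (by simp) (.inr rfl) h p.1
  refine ⟨⟨(q.1, p + I • q), ?_, Γ.add_mem hp (Γ.smul_mem _ hq)⟩, ?_⟩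
  · have : p.1 + I • q.1 = q.2 := by
      rw [← hqp]
      module
    simpa [this] using hq
  · simp only [addSq, LinearMap.add_apply, LinearMap.snd_apply, LinearMap.smul_apply,
      LinearMap.fst_apply, LinearMap.comp_apply, Submodule.subtype_apply, Prod.snd_add,
      Prod.smul_snd, ← hqp]
    match_scalars
    · simp
    · ring
    · simp

theorem surjective_addSq_of_lt (hΓ : IsSelfAdjointGraph A Γ) {s t : ℝ} (hs : 0 < s) (ht : 0 < t)
    (hst : t < 2 * s) (h : Function.Surjective (addSq Γ s)) : Function.Surjective (addSq Γ t) := by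
  refine surjective_of_norm_sub_le h (θ := |t - s| / s) ?_ fun p => ?_
  · rw [div_lt_one hs, abs_lt]
    constructor <;> linarith
  · have h1 : addSq Γ t p - addSq Γ s p = ((t - s : ℝ) : ℂ) • p.1.1 := by
      simp only [addSq, LinearMap.add_apply, LinearMap.snd_apply, LinearMap.smul_apply,
        LinearMap.fst_apply, LinearMap.comp_apply, Submodule.subtype_apply]
      push_cast
      module
    rw [h1, norm_smul, norm_real, Real.norm_eq_abs, div_mul_eq_mul_div, mul_div_assoc]
    gcongr
    rw [le_div_iff₀' hs]
    exact hΓ.mul_norm_fst_le_norm_addSq hs.le p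

/-- One perturbation step raises the parameter by any factor below 2, so powers of 3/2 reach every
size; any decrease takes a single step. -/
theorem surjective_addSq (hΓ : IsSelfAdjointGraph A Γ) (h : Dense (Set.range (addSq Γ 1))) {s : ℝ}
    (hs : 0 < s) : Function.Surjective (addSq Γ s) := by
  have h1 : ∀ n : ℕ, Function.Surjective (addSq Γ (((3 / 2 : ℝ) ^ n : ℝ) : ℂ)) := by
    intro n
    induction n with
    | zero => simpa using hΓ.surjective_addSq_one h
    | succ n ih =>
      have : 0 < (3 / 2 : ℝ) ^ n := by positivity
      refine hΓ.surjective_addSq_of_lt this (by positivity) ?_ ih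
      rw [pow_succ]
      linarith
  obtain ⟨n, hn⟩ := pow_unbounded_of_one_lt s (by norm_num : (1 : ℝ) < 3 / 2)
  exact hΓ.surjective_addSq_of_lt (by positivity) hs (by linarith) (h1 n)

/-- The resolvents `(1 + isD)⁻¹` are everywhere defined. -/
theorem exists_add_smul (hΓ : IsSelfAdjointGraph A Γ) (h : Dense (Set.range (addSq Γ 1))) {s : ℝ}
    (hs : 0 < s) (y : X) : ∃ p ∈ Γ, p.1 + (s * I) • p.2 = y := by
  have hs' : (s : ℂ) ≠ 0 := ofReal_ne_zero.2 hs.ne'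
  obtain ⟨p, hp⟩ := hΓ.surjective_addSq h (s := (s ^ 2)⁻¹) (by positivity) y
  -- The witness is s⁻²(1 - isD)u with (s⁻² + D²)u = y, from 1 + s²D² = (1 + isD)(1 - isD).
  refine ⟨((s ^ 2)⁻¹ : ℂ) • (p.1.1, p.1.2.1) - (I / s) • p.1.2,
    Γ.sub_mem (Γ.smul_mem _ p.2.1) (Γ.smul_mem _ p.2.2), ?_⟩
  rw [← hp]
  simp only [addSq, LinearMap.add_apply, LinearMap.snd_apply, LinearMap.smul_apply,
    LinearMap.fst_apply, LinearMap.comp_apply, Submodule.subtype_apply, Prod.fst_sub,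
    Prod.snd_sub, Prod.smul_fst, Prod.smul_snd]
  push_cast
  match_scalars
  · simp
  · field_simp
    ring
  · field_simp
    linear_combination -I_sq

omit [CompleteSpace X] in
/-- The resolvents `(1 + isD)⁻¹` converge strongly to `1` for `s → 0`. -/
theorem exists_forall_norm_sub_le (hΓ : IsSelfAdjointGraph A Γ)
    (y : X) {ε : ℝ} (hε : 0 < ε) :
    ∃ t > 0, ∀ s : ℝ, 0 < s → s < t → ∀ p ∈ Γ, p.1 + (s * I) • p.2 = y → ‖p.1 - y‖ ≤ ε := by
  obtain ⟨_, hy, ⟨q, hq, rfl⟩⟩ := Metric.dense_iff.1 hΓ.dense y (ε / 3) (by positivity)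
  rw [Metric.mem_ball, dist_eq_norm] at hy
  simp only [LinearMap.fst_apply] at hy
  refine ⟨ε / 3 / (‖q.2‖ + 1), by positivity, fun s hs hst p hp hpy => ?_⟩
  -- For q in Dom D near y, contractivity of the resolvent bounds p - q by (y - q) - isDq.
  have h1 := hΓ.norm_fst_le s (Γ.sub_mem hp hq)
  simp only [Prod.fst_sub, Prod.snd_sub] at h1
  have h2 : p.1 - q.1 + (s * I) • (p.2 - q.2) = (y - q.1) - (s * I) • q.2 := by
    rw [← hpy]
    module
  rw [h2] at h1
  have h3 : ‖((s : ℂ) * I) • q.2‖ ≤ ε / 3 := by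
    rw [norm_smul]
    simp only [Complex.norm_mul, norm_real, norm_I, mul_one, Real.norm_of_nonneg hs.le]
    calc s * ‖q.2‖ ≤ ε / 3 / (‖q.2‖ + 1) * (‖q.2‖ + 1) := by gcongr; linarith
      _ = ε / 3 := by field_simp
  have h4 := norm_sub_le (y - q.1) ((s * I) • q.2)
  have h5 := norm_add_le (p.1 - q.1) (q.1 - y)
  rw [sub_add_sub_cancel] at h5
  rw [norm_sub_rev] at hy
  rw [norm_sub_rev q.1] at h5
  linarith

end IsSelfAdjointGraph

/-! ### Core, adjoint and lower bound for D x -/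

/-- The graph of `D x`, for `D` with graph `Γ`. -/
def mulGraph {X : Type*} [NormedAddCommGroup X] [NormedSpace ℂ X] (Γ : Submodule ℂ (X × X))
    (x : X →L[ℂ] X) : Submodule ℂ (X × X) :=
  Γ.comap ((x : X →ₗ[ℂ] X).prodMap LinearMap.id)

/-- The bounded selfadjoint operator `x` preserves the domain of the operator with graph `Γ`, and
the commutator of this operator with `x` is the restriction of the bounded operator `d`. -/
structure IsCommutator (A : Type*) {X : Type*} [NonUnitalCStarAlgebra A] [PartialOrder A]
    [NormedAddCommGroup X] [NormedSpace ℂ X] [SMul A X] [CStarModule A X]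
    (Γ : Submodule ℂ (X × X)) (x d : X →L[ℂ] X) : Prop where
  inner_apply_left : ∀ ξ η : X, inner A (x ξ) η = inner A ξ (x η)
  apply_mem : ∀ p ∈ Γ, (x p.1, x p.2 + d p.1) ∈ Γ

namespace IsCommutator

variable {A X : Type*} [NonUnitalCStarAlgebra A] [PartialOrder A] [StarOrderedRing A]
  [NormedAddCommGroup X] [NormedSpace ℂ X] [SMul A X] [CStarModule A X]
  {Γ : Submodule ℂ (X × X)} {x d : X →L[ℂ] X}

omit [StarOrderedRing A] in
theorem neg (h : IsCommutator A Γ x d) : IsCommutator A Γ (-x) (-d) where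
  inner_apply_left ξ η := by simp [h.inner_apply_left]
  apply_mem p hp := by
    have := Γ.neg_mem (h.apply_mem p hp)
    convert this using 2 <;> simp [add_comm]

omit [StarOrderedRing A] in
theorem mem_mulGraph (h : IsCommutator A Γ x d) {p : X × X} (hp : p ∈ Γ) :
    (p.1, x p.2 + d p.1) ∈ mulGraph Γ x :=
  h.apply_mem p hp

theorem isClosed_mulGraph (hΓ : IsSelfAdjointGraph A Γ) (x : X →L[ℂ] X) :
    IsClosed (mulGraph Γ x : Set (X × X)) :=
  hΓ.isClosed.preimage (x.continuous.prodMap continuous_id)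

/-- The commutator of two selfadjoint operators is skew-adjoint. -/
theorem inner_commutator_left (h : IsCommutator A Γ x d) (hΓ : IsSelfAdjointGraph A Γ) (ξ η : X) :
    inner A (d ξ) η = -inner A ξ (d η) := by
  have hS := hΓ.dense
  refine hS.induction (P := fun ξ => inner A (d ξ) η = -inner A ξ (d η)) ?_
    (isClosed_eq (by fun_prop) (by fun_prop)) ξ
  rintro _ ⟨p, hp, rfl⟩
  refine hS.induction (P := fun η => inner A (d p.1) η = -inner A p.1 (d η)) ?_
    (isClosed_eq (by fun_prop) (by fun_prop)) η
  rintro _ ⟨q, hq, rfl⟩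
  have h1 := hΓ.symm _ (h.apply_mem p hp) _ hq
  have h2 := hΓ.symm _ hp _ (h.apply_mem q hq)
  simp only [LinearMap.fst_apply, CStarModule.inner_add_left, CStarModule.inner_add_right,
    h.inner_apply_left] at h1 h2 ⊢
  rw [h2] at h1
  rw [eq_neg_iff_add_eq_zero, ← sub_eq_zero.2 h1]
  abel

omit [StarOrderedRing A] in
/-- If `p = (1 + isD)⁻¹ ξ` and `r = (1 + isD)⁻¹ (d p)`, with `ξ` in the domain of `D x`, then
`D x p - d p + r = (1 + isD)⁻¹ (D x ξ)`. -/
theorem apply_snd_add_mem (h : IsCommutator A Γ x d) {s : ℝ} (hs : s ≠ 0) {q p r : X × X}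
    (hq : q ∈ mulGraph Γ x) (hp : p ∈ Γ) (hpq : p.1 + (s * I) • p.2 = q.1) (hr : r ∈ Γ)
    (hrp : r.1 + (s * I) • r.2 = d p.1) :
    ∃ z, (x p.2 + r.1, z) ∈ Γ ∧ x p.2 + r.1 + (s * I) • z = q.2 := by
  have hs' : (s : ℂ) ≠ 0 := ofReal_ne_zero.2 hs
  -- Since Dp = (ξ - p)/(is), the vector xDp = (xξ - xp)/(is) is a combination of two elements of
  -- Dom D.
  have h1 := Γ.smul_mem ((s * I)⁻¹ : ℂ) (Γ.sub_mem hq (h.apply_mem p hp))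
  have h2 : ((s * I)⁻¹ : ℂ) • (q.1 - p.1) = p.2 := by
    rw [← hpq, add_sub_cancel_left, smul_smul, inv_mul_cancel₀ (by simp [hs']), one_smul]
  have h3 : ((s * I)⁻¹ : ℂ) • (x q.1 - x p.1) = x p.2 := by
    rw [← map_sub, ← map_smul, h2]
  have h4 := Γ.add_mem h1 hr
  refine ⟨((s * I)⁻¹ : ℂ) • (q.2 - (x p.2 + d p.1)) + r.2, ?_, ?_⟩
  · have h5 : (((s * I)⁻¹ : ℂ) • (x q.1 - x p.1) + r.1,
        ((s * I)⁻¹ : ℂ) • (q.2 - (x p.2 + d p.1)) + r.2) ∈ Γ := h4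
    rwa [h3] at h5
  · rw [smul_add, smul_smul, mul_inv_cancel₀ (by simp [hs']), ← hrp]
    module

variable [CompleteSpace X]

/-- The domain of `D` is a core for `D x`. -/
theorem mem_closure (h : IsCommutator A Γ x d) (hΓ : IsSelfAdjointGraph A Γ)
    (hd : Dense (Set.range (addSq Γ 1))) {q : X × X} (hq : q ∈ mulGraph Γ x) :
    q ∈ closure {w : X × X | ∃ p ∈ Γ, w = (p.1, x p.2 + d p.1)} := by
  rw [Metric.mem_closure_iff]
  intro ε hε
  set δ := ε / (4 * (‖d‖ + 1)) with hδ_def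
  have hδ : 0 < δ := by positivity
  have hδε : 4 * (‖d‖ + 1) * δ = ε := by rw [hδ_def]; field_simp
  obtain ⟨t₁, ht₁, h₁⟩ := hΓ.exists_forall_norm_sub_le q.1 hδ
  obtain ⟨t₂, ht₂, h₂⟩ := hΓ.exists_forall_norm_sub_le q.2 hδ
  obtain ⟨t₃, ht₃, h₃⟩ := hΓ.exists_forall_norm_sub_le (d q.1) hδ
  obtain ⟨s, hs, hs'⟩ := exists_between (lt_min ht₁ (lt_min ht₂ ht₃))
  rw [lt_min_iff, lt_min_iff] at hs'
  obtain ⟨p, hp, hpq⟩ := hΓ.exists_add_smul hd hs q.1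
  obtain ⟨r, hr, hrp⟩ := hΓ.exists_add_smul hd hs (d p.1)
  -- The argument d p of the resolvent defining r varies with s, so r is compared with the resolvent
  -- of the fixed vector d q.
  obtain ⟨r', hr', hrq⟩ := hΓ.exists_add_smul hd hs (d q.1)
  obtain ⟨z, hz, hzq⟩ := h.apply_snd_add_mem hs.ne' hq hp hpq hr hrp
  have e1 := h₁ s hs hs'.1 p hp hpq
  have e2 := h₂ s hs hs'.2.1 _ hz hzq
  have e3 := h₃ s hs hs'.2.2 r' hr' hrq
  have e4 := hΓ.norm_fst_le s (Γ.sub_mem hr hr')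
  have e5 : (r - r').1 + (s * I) • (r - r').2 = d (p.1 - q.1) := by
    rw [map_sub, ← hrp, ← hrq, Prod.fst_sub, Prod.snd_sub]
    module
  rw [e5] at e4
  have e6 := d.le_opNorm (p.1 - q.1)
  have e7 : ‖d‖ * ‖p.1 - q.1‖ ≤ ‖d‖ * δ := by gcongr
  refine ⟨_, ⟨p, hp, rfl⟩, ?_⟩
  rw [dist_comm, dist_eq_norm, Prod.norm_def, max_lt_iff]
  have hd0 := norm_nonneg d
  constructor
  · refine e1.trans_lt ?_
    nlinarith
  · have e8 : x p.2 + d p.1 - q.2 =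
        (x p.2 + r.1 - q.2) - (r - r').1 - (r'.1 - d q.1) + d (p.1 - q.1) := by
      rw [map_sub, Prod.fst_sub]
      abel
    have e9 := norm_add_le ((x p.2 + r.1 - q.2) - (r - r').1 - (r'.1 - d q.1)) (d (p.1 - q.1))
    have e10 := norm_sub_le ((x p.2 + r.1 - q.2) - (r - r').1) (r'.1 - d q.1)
    have e11 := norm_sub_le (x p.2 + r.1 - q.2) (r - r').1
    simp only [Prod.snd_sub]
    rw [e8]
    simp only at e2
    nlinarith

/-- The operators `D x` and `D x - d` are adjoint to each other. -/
theorem inner_mulGraph (h : IsCommutator A Γ x d) (hΓ : IsSelfAdjointGraph A Γ)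
    (hd : Dense (Set.range (addSq Γ 1))) {q w : X × X} (hq : q ∈ mulGraph Γ x)
    (hw : w ∈ mulGraph Γ x) : inner A q.2 w.1 = inner A q.1 (w.2 - d w.1) := by
  have hc : IsClosed {q : X × X | inner A q.2 w.1 = inner A q.1 (w.2 - d w.1)} :=
    isClosed_eq (by fun_prop) (by fun_prop)
  refine hc.closure_subset_iff.2 ?_ (h.mem_closure hΓ hd hq)
  rintro _ ⟨p, hp, rfl⟩
  have h1 := hΓ.symm p hp _ hw
  have h2 := h.inner_commutator_left hΓ p.1 w.1
  simp only [Set.mem_ofPred_eq, CStarModule.inner_add_left, CStarModule.inner_sub_right,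
    h.inner_apply_left, h2]
  simp only [LinearMap.prodMap_apply, ContinuousLinearMap.coe_coe, LinearMap.id_apply] at h1
  rw [h1]
  abel

-- Testing on Dom D suffices: there D x = xD + d, and moving x and d across the pairing puts x w
-- into Dom D⋆ = Dom D.
omit [CompleteSpace X] in
theorem mem_mulGraph_of_inner (h : IsCommutator A Γ x d) (hΓ : IsSelfAdjointGraph A Γ)
    {w : X × X} (hw : ∀ q ∈ mulGraph Γ x, inner A q.2 w.1 = inner A q.1 w.2) :
    (w.1, w.2 + d w.1) ∈ mulGraph Γ x := by
  refine hΓ.maximal _ fun p hp => ?_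
  have h1 := hw (p.1, x p.2 + d p.1) (h.apply_mem p hp)
  have h2 := h.inner_commutator_left hΓ p.1 w.1
  simp only [CStarModule.inner_add_left, h.inner_apply_left, h2] at h1
  simp only [LinearMap.prodMap_apply, ContinuousLinearMap.coe_coe, LinearMap.id_apply,
    CStarModule.inner_add_right, ← h1]
  abel

theorem norm_mulGraph_le (h : IsCommutator A Γ x d) (hΓ : IsSelfAdjointGraph A Γ)
    (hd : Dense (Set.range (addSq Γ 1))) {μ : ℝ} (hμ : 0 ≤ μ) {q : X × X}
    (hq : q ∈ mulGraph Γ x) : (μ - ‖d‖) * ‖q.1‖ ≤ ‖q.2 + (μ * I) • q.1‖ := by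
  have h1 : inner A q.1 (q.2 + (μ * I) • q.1) - inner A (q.2 + (μ * I) • q.1) q.1 =
      (2 * I) • (μ • inner A q.1 q.1 + (0 : ℝ) • inner A q.1 q.1) + inner A q.1 (d q.1) := by
    have h2 := h.inner_mulGraph hΓ hd hq hq
    simp only [CStarModule.inner_add_left, CStarModule.inner_add_right,
      CStarModule.inner_smul_left_complex, CStarModule.inner_smul_right_complex, h2,
      CStarModule.inner_sub_right, zero_smul, add_zero]
    rw [← Complex.coe_smul]
    simp only [star_mul', RCLike.star_def, conj_ofReal, conj_I]
    module
  have h3 := norm_le_of_inner_sub_inner h1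
  have h4 := mul_sq_le_norm_smul_add (A := A) hμ le_rfl q.1 q.1
  have h5 := d.le_opNorm q.1
  rcases (norm_nonneg q.1).eq_or_lt with h0 | h0
  · rw [← h0]
    simp
  · refine le_of_mul_le_mul_left ?_ h0
    nlinarith

end IsCommutator

/-! ### Elliptic regularization -/

/-- The elliptic regularization `D x + iμ + iηD²` of `D x + iμ`, on the domain of `D²`. -/
def regularized {X : Type*} [NormedAddCommGroup X] [NormedSpace ℂ X] (Γ : Submodule ℂ (X × X))
    (x d : X →L[ℂ] X) (η μ : ℝ) : sqGraph Γ →ₗ[ℂ] X :=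
  ((x : X →ₗ[ℂ] X) ∘ₗ LinearMap.fst ℂ X X ∘ₗ LinearMap.snd ℂ X (X × X) +
    (d : X →ₗ[ℂ] X) ∘ₗ LinearMap.fst ℂ X (X × X) +
    (μ * I) • LinearMap.fst ℂ X (X × X) +
    (η * I) • LinearMap.snd ℂ X X ∘ₗ LinearMap.snd ℂ X (X × X)) ∘ₗ (sqGraph Γ).subtype

theorem regularized_apply {X : Type*} [NormedAddCommGroup X] [NormedSpace ℂ X]
    {Γ : Submodule ℂ (X × X)} {x d : X →L[ℂ] X} {η μ : ℝ} (p : sqGraph Γ) :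
    regularized Γ x d η μ p =
      x p.1.2.1 + d p.1.1 + (μ * I) • p.1.1 + (η * I) • p.1.2.2 := rfl

namespace IsCommutator

variable {A X : Type*} [NonUnitalCStarAlgebra A] [PartialOrder A] [StarOrderedRing A]
  [NormedAddCommGroup X] [NormedSpace ℂ X] [SMul A X] [CStarModule A X]
  {Γ : Submodule ℂ (X × X)} {x d : X →L[ℂ] X}

variable [CompleteSpace X]

/-- The term iηD² contributes the positive energy η⟨Dp, Dp⟩, which gives control of Dp besides that
of p. -/
theorem norm_smul_inner_add_le (h : IsCommutator A Γ x d) (hΓ : IsSelfAdjointGraph A Γ)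
    (hd : Dense (Set.range (addSq Γ 1))) (η μ : ℝ) (p : sqGraph Γ) :
    ‖μ • inner A p.1.1 p.1.1 + η • inner A p.1.2.1 p.1.2.1‖ ≤
      ‖p.1.1‖ * (‖regularized Γ x d η μ p‖ + ‖d‖ * ‖p.1.1‖) := by
  have h1 : inner A p.1.1 (regularized Γ x d η μ p) - inner A (regularized Γ x d η μ p) p.1.1 =
      (2 * I) • (μ • inner A p.1.1 p.1.1 + η • inner A p.1.2.1 p.1.2.1) +
        inner A p.1.1 (d p.1.1) := by
    have h2 := h.inner_mulGraph hΓ hd (h.mem_mulGraph p.2.1) (h.mem_mulGraph p.2.1)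
    have h3 := hΓ.symm _ p.2.1 _ p.2.2
    have h4 := hΓ.symm _ p.2.2 _ p.2.1
    simp only [add_sub_cancel_right, CStarModule.inner_add_left] at h2 h3 h4
    rw [regularized_apply]
    simp only [CStarModule.inner_add_left, CStarModule.inner_add_right,
      CStarModule.inner_smul_left_complex, CStarModule.inner_smul_right_complex, h2, ← h3, h4]
    rw [← Complex.coe_smul, ← Complex.coe_smul]
    simp only [star_mul', RCLike.star_def, conj_ofReal, conj_I]
    module
  refine (norm_le_of_inner_sub_inner h1).trans ?_
  gcongr
  exact d.le_opNorm _

theorem norm_fst_le_regularized (h : IsCommutator A Γ x d) (hΓ : IsSelfAdjointGraph A Γ)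
    (hd : Dense (Set.range (addSq Γ 1))) {η μ : ℝ} (hη : 0 ≤ η) (hμ : 0 ≤ μ) (p : sqGraph Γ) :
    (μ - ‖d‖) * ‖p.1.1‖ ≤ ‖regularized Γ x d η μ p‖ := by
  have h1 := h.norm_smul_inner_add_le hΓ hd η μ p
  have h2 := mul_sq_le_norm_smul_add (A := A) hμ hη p.1.1 p.1.2.1
  rcases (norm_nonneg p.1.1).eq_or_lt with h0 | h0
  · rw [← h0]
    simp
  · refine le_of_mul_le_mul_left ?_ h0
    nlinarith

theorem norm_snd_sq_le_regularized (h : IsCommutator A Γ x d) (hΓ : IsSelfAdjointGraph A Γ)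
    (hd : Dense (Set.range (addSq Γ 1))) {η μ : ℝ} (hη : 0 ≤ η) (hμ : 0 ≤ μ) (p : sqGraph Γ) :
    η * ‖p.1.2.1‖ ^ 2 ≤ ‖p.1.1‖ * (‖regularized Γ x d η μ p‖ + ‖d‖ * ‖p.1.1‖) := by
  have h1 := h.norm_smul_inner_add_le hΓ hd η μ p
  have h2 := mul_sq_le_norm_smul_add (A := A) hη hμ p.1.2.1 p.1.1
  rw [add_comm] at h2
  exact h2.trans h1

theorem surjective_regularized (h : IsCommutator A Γ x d) (hΓ : IsSelfAdjointGraph A Γ)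
    (hd : Dense (Set.range (addSq Γ 1))) {η μ : ℝ} (hη : 0 < η) (hμ : ‖d‖ < μ) :
    Function.Surjective (regularized Γ x d η μ) := by
  -- With s ≥ k, the perturbation xD + d is at most half of iη(s² + D²); the further summands of s
  -- give s ≥ 1 and μ ≤ ηs².
  set k := 2 * (‖x‖ + ‖d‖) / η with hk
  have hk0 : 0 ≤ k := by positivity
  have hμ0 : 0 < μ := (norm_nonneg d).trans_lt hμ
  set s := k + 1 + μ / η with hs
  have hs1 : 1 ≤ s := by
    have : 0 ≤ μ / η := by positivity
    linarith
  have hsk : k ≤ s := by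
    have : 0 ≤ μ / η := by positivity
    linarith
  have hs0 : 0 < s := by linarith
  have hsμ : μ ≤ η * s ^ 2 := by
    have h1 : μ = η * (μ / η) := by field_simp
    have h2 : μ / η ≤ s := by linarith
    calc μ = η * (μ / η) := h1
      _ ≤ η * s ^ 2 := by gcongr; nlinarith
  have hlarge : Function.Surjective (regularized Γ x d η (η * s ^ 2)) := by
    have hG : Function.Surjective ((η * I) • addSq Γ ((s ^ 2 : ℝ) : ℂ)) := by
      intro y
      obtain ⟨p, hp⟩ := hΓ.surjective_addSq hd (s := s ^ 2) (by positivity) ((η * I : ℂ)⁻¹ • y)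
      refine ⟨p, ?_⟩
      rw [LinearMap.smul_apply, hp, smul_smul, mul_inv_cancel₀, one_smul]
      simp [hη.ne']
    refine surjective_of_norm_sub_le hG (θ := 1 / 2) (by norm_num) fun p => ?_
    have h1 : regularized Γ x d η (η * s ^ 2) p - ((η * I) • addSq Γ ((s ^ 2 : ℝ) : ℂ)) p =
        x p.1.2.1 + d p.1.1 := by
      rw [regularized_apply]
      simp only [addSq, LinearMap.add_apply, LinearMap.snd_apply, LinearMap.smul_apply,
        LinearMap.fst_apply, LinearMap.comp_apply, Submodule.subtype_apply]
      push_cast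
      module
    rw [h1, LinearMap.smul_apply, norm_smul]
    have h2 := hΓ.mul_norm_fst_le_norm_addSq (s := s ^ 2) (by positivity) p
    have h3 := hΓ.norm_snd_sq_le (s := s ^ 2) (by positivity) p
    set n := ‖addSq Γ ((s ^ 2 : ℝ) : ℂ) p‖ with hn
    have hn0 : 0 ≤ n := norm_nonneg _
    have h4 : ‖p.1.1‖ ≤ n / s := by
      rw [le_div_iff₀' hs0]
      refine le_trans ?_ h2
      gcongr
      nlinarith
    have h5 : ‖p.1.2.1‖ ≤ n / s := by
      refine abs_le_of_sq_le_sq' ?_ (by positivity) |>.2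
      rw [div_pow, le_div_iff₀' (by positivity)]
      calc s ^ 2 * ‖p.1.2.1‖ ^ 2 ≤ s ^ 2 * (‖p.1.1‖ * n) := by gcongr
        _ = (s ^ 2 * ‖p.1.1‖) * n := by ring
        _ ≤ n * n := by gcongr
        _ = n ^ 2 := by ring
    have h6 : ‖((η : ℂ) * I)‖ = η := by simp [abs_of_pos hη]
    rw [h6]
    calc ‖x p.1.2.1 + d p.1.1‖ ≤ ‖x p.1.2.1‖ + ‖d p.1.1‖ := norm_add_le _ _
      _ ≤ ‖x‖ * ‖p.1.2.1‖ + ‖d‖ * ‖p.1.1‖ := add_le_add (x.le_opNorm _) (d.le_opNorm _)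
      _ ≤ ‖x‖ * (n / s) + ‖d‖ * (n / s) := by gcongr
      _ = k * (η / 2) * (n / s) := by rw [hk]; field_simp
      _ ≤ s * (η / 2) * (n / s) := by gcongr
      _ = 1 / 2 * (η * n) := by field_simp
  have hm : 0 < η * s ^ 2 - ‖d‖ := by linarith
  -- From ηs² one step descends to μ: the relative bound is below 1 exactly because μ > ‖d‖.
  refine surjective_of_norm_sub_le hlarge (θ := (η * s ^ 2 - μ) / (η * s ^ 2 - ‖d‖)) ?_
    fun p => ?_
  · rw [div_lt_one hm]
    linarith
  · have h1 : regularized Γ x d η μ p - regularized Γ x d η (η * s ^ 2) p =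
        -(((η * s ^ 2 - μ : ℝ) * I : ℂ) • p.1.1) := by
      rw [regularized_apply, regularized_apply]
      push_cast
      module
    have h2 := h.norm_fst_le_regularized hΓ hd hη.le (μ := η * s ^ 2) (by positivity) p
    rw [h1, norm_neg, norm_smul, norm_mul, norm_real, norm_I, mul_one,
      Real.norm_of_nonneg (by linarith), div_mul_eq_mul_div, mul_div_assoc]
    refine mul_le_mul_of_nonneg_left ?_ (by linarith)
    rwa [le_div_iff₀' hm]

/-- Elements of the domain of `D` are approximated by values of `D x + iμ`. -/
theorem exists_norm_sub_le (h : IsCommutator A Γ x d) (hΓ : IsSelfAdjointGraph A Γ)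
    (hd : Dense (Set.range (addSq Γ 1))) {μ : ℝ} (hμ : 4 * ‖d‖ + 1 ≤ μ) {w : X × X}
    (hw : w ∈ Γ) : ∃ q ∈ mulGraph Γ x, ‖q.2 + (μ * I) • q.1 - w.1‖ ≤ 3 / 4 * ‖w.1‖ := by
  rcases (norm_nonneg w.1).eq_or_lt with hw0 | hw0
  · refine ⟨0, zero_mem _, ?_⟩
    simp [← hw0]
  have hc := norm_nonneg d
  set y := w.1 + ((1 : ℝ) * I) • w.2 with hy
  set N := ‖y‖ * (‖y‖ + ‖d‖ * ‖y‖) with hN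
  set ρ := ‖w.1‖ / 6 with hρ
  have hρ0 : 0 < ρ := by positivity
  -- `η` is so small that `η * N ≤ (ρ / 2) ^ 2` and `η * ‖y‖ ≤ ρ / 2`
  obtain ⟨η, hη, hηN, hηy⟩ : ∃ η : ℝ, 0 < η ∧ η * N ≤ (ρ / 2) ^ 2 ∧ η * ‖y‖ ≤ ρ / 2 := by
    refine ⟨min ((ρ / 2) ^ 2 / (N + 1)) (ρ / 2 / (‖y‖ + 1)), by positivity, ?_, ?_⟩
    · calc _ ≤ (ρ / 2) ^ 2 / (N + 1) * (N + 1) := by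
            gcongr
            · exact min_le_left _ _
            · linarith
        _ = _ := div_mul_cancel₀ _ (by positivity)
    · calc _ ≤ ρ / 2 / (‖y‖ + 1) * (‖y‖ + 1) := by
            gcongr
            · exact min_le_right _ _
            · linarith
        _ = _ := by field_simp
  obtain ⟨v, hv⟩ := h.surjective_regularized hΓ hd hη (by linarith : ‖d‖ < μ) y
  -- Smoothing the solution: p = (1 + iD)⁻¹v, and the resolvent is carried through the equation for
  -- v.
  obtain ⟨p, hp, hpv⟩ := hΓ.exists_add_smul hd one_pos v.1.1
  obtain ⟨r, hr, hrp⟩ := hΓ.exists_add_smul hd one_pos (d p.1)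
  obtain ⟨z, hz, hzv⟩ :=
    h.apply_snd_add_mem one_ne_zero (h.mem_mulGraph v.2.1) hp hpv hr hrp
  simp only [ofReal_one, one_mul] at hpv hrp hzv hy
  -- `p.1` lies in the domain of `D³`
  have hp2 : p.2 = -I • (v.1.1 - p.1) := by
    rw [← hpv, add_sub_cancel_left, smul_smul]
    simp
  have hpΓ : (p.2, -I • (v.1.2.1 - p.2)) ∈ Γ := by
    have : (-I • (v.1.1 - p.1), -I • (v.1.2.1 - p.2)) ∈ Γ :=
      Γ.smul_mem (-I) (Γ.sub_mem v.2.1 hp)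
    rwa [← hp2] at this
  have hpΓ' : (-I • (v.1.2.1 - p.2), -I • (v.1.2.2 - -I • (v.1.2.1 - p.2))) ∈ Γ :=
    Γ.smul_mem (-I) (Γ.sub_mem v.2.2 hpΓ)
  have hsum := Γ.sub_mem (Γ.add_mem (Γ.add_mem hz (Γ.smul_mem (μ * I) hp))
    (Γ.smul_mem (η * I) hpΓ')) hw
  -- 1 + iD is injective, so the smoothed equation `hval` may be checked after applying it.
  have hzero := hΓ.norm_fst_le 1 hsum
  have hval : x p.2 + r.1 + (μ * I) • p.1 + (η * I) • -I • (v.1.2.1 - p.2) = w.1 := by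
    rw [← sub_eq_zero, ← norm_le_zero_iff]
    refine hzero.trans (le_of_eq ?_)
    rw [norm_eq_zero]
    rw [regularized_apply, hy, ← sub_eq_zero] at hv
    rw [← hv, ← hzv]
    rw [← hpv]
    simp only [ofReal_one, one_mul, Prod.fst_sub, Prod.snd_sub, Prod.fst_add, Prod.snd_add,
      Prod.smul_fst, Prod.smul_snd]
    match_scalars
    all_goals first
      | ring1
      | linear_combination (-η * I ^ 2) * I_sq
      | linear_combination (η * I ^ 2) * I_sq
      | linear_combination (-η * I) * I_sq
  have hq := h.mem_mulGraph hp
  refine ⟨(p.1, x p.2 + d p.1), hq, ?_⟩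
  have e1 : x p.2 + d p.1 + (μ * I) • p.1 - w.1 = I • r.2 - (η : ℂ) • (v.1.2.1 - p.2) := by
    rw [← hval, ← hrp]
    match_scalars
    all_goals first
      | ring1
      | linear_combination (η : ℂ) * I_sq
      | linear_combination (-η : ℂ) * I_sq
  have e2 : ‖I • r.2‖ ≤ ‖d‖ * ‖p.1‖ := by
    have := hΓ.norm_smul_snd_le 1 hr
    simp only [ofReal_one, one_mul, hrp] at this
    exact this.trans (d.le_opNorm _)
  have e3 : ‖v.1.1‖ ≤ ‖y‖ := by
    have h1 := h.norm_fst_le_regularized hΓ hd hη.le (by linarith : 0 ≤ μ) v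
    rw [hv] at h1
    nlinarith [norm_nonneg v.1.1]
  have e4 : ‖p.2‖ ≤ ‖y‖ := by
    have := hΓ.norm_smul_snd_le 1 hp
    simp only [ofReal_one, one_mul, hpv, norm_smul, norm_I] at this
    exact this.trans e3
  have e5 : η * ‖v.1.2.1‖ ≤ ρ / 2 := by
    have h1 := h.norm_snd_sq_le_regularized hΓ hd hη.le (by linarith : 0 ≤ μ) v
    rw [hv] at h1
    refine (abs_le_of_sq_le_sq' ?_ (by positivity)).2
    calc (η * ‖v.1.2.1‖) ^ 2 = η * (η * ‖v.1.2.1‖ ^ 2) := by ring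
      _ ≤ η * (‖v.1.1‖ * (‖y‖ + ‖d‖ * ‖v.1.1‖)) := by gcongr
      _ ≤ η * N := by rw [hN]; gcongr
      _ ≤ _ := hηN
  have e6 : ‖(η : ℂ) • (v.1.2.1 - p.2)‖ ≤ ρ := by
    rw [norm_smul, norm_real, Real.norm_of_nonneg hη.le]
    calc η * ‖v.1.2.1 - p.2‖ ≤ η * (‖v.1.2.1‖ + ‖p.2‖) := by gcongr; exact norm_sub_le _ _
      _ = η * ‖v.1.2.1‖ + η * ‖p.2‖ := by ring
      _ ≤ ρ / 2 + η * ‖y‖ := by gcongr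
      _ ≤ ρ := by linarith
  have e7 := norm_sub_le (I • r.2) ((η : ℂ) • (v.1.2.1 - p.2))
  have e8 := h.norm_mulGraph_le hΓ hd (by linarith : 0 ≤ μ) (q := (p.1, x p.2 + d p.1)) hq
  have e9 : ‖x p.2 + d p.1 + (μ * I) • p.1‖ ≤
      ‖x p.2 + d p.1 + (μ * I) • p.1 - w.1‖ + ‖w.1‖ := by
    simpa using norm_add_le (x p.2 + d p.1 + (μ * I) • p.1 - w.1) w.1
  simp only at e8 ⊢
  rw [e1] at e9 ⊢
  -- The error e satisfies e ≤ ‖d‖‖p‖ + ‖w‖/6 and 3‖d‖‖p‖ ≤ e + ‖w‖, hence e ≤ 3/4 ‖w‖.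
  have e10 : (3 * ‖d‖ + 1) * ‖p.1‖ ≤ (μ - ‖d‖) * ‖p.1‖ := by
    gcongr
    linarith
  have e11 := norm_nonneg p.1
  linarith

end IsCommutator

/-! ### Surjectivity of D x ± iμ and of 1 + (D x)⋆D x -/

namespace IsCommutator

variable {A X : Type*} [NonUnitalCStarAlgebra A] [PartialOrder A] [StarOrderedRing A]
  [NormedAddCommGroup X] [NormedSpace ℂ X] [SMul A X] [CStarModule A X]
  {Γ : Submodule ℂ (X × X)} {x d : X →L[ℂ] X}

variable [CompleteSpace X]

/-- `D x + iμ` is surjective for large `μ`. -/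
theorem exists_add_smul (h : IsCommutator A Γ x d) (hΓ : IsSelfAdjointGraph A Γ)
    (hd : Dense (Set.range (addSq Γ 1))) {μ : ℝ} (hμ : 4 * ‖d‖ + 1 ≤ μ) (y : X) :
    ∃ q ∈ mulGraph Γ x, q.2 + (μ * I) • q.1 = y := by
  have hc := norm_nonneg d
  have hcl := isClosed_map_of_le (isClosed_mulGraph hΓ x) (by linarith : 0 < μ - ‖d‖)
    fun q hq => h.norm_mulGraph_le hΓ hd (by linarith) hq
  have hy := mem_of_forall_dense_norm_sub_le hcl hΓ.dense (fun g hg => ?_) y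
  · obtain ⟨q, hq, hqy⟩ := hy
    exact ⟨q, hq, by simpa using hqy⟩
  · obtain ⟨w, hw, rfl⟩ := hg
    obtain ⟨q, hq, hqw⟩ := h.exists_norm_sub_le hΓ hd hμ hw
    exact ⟨_, ⟨q, hq, rfl⟩, hqw⟩

/-- `D x - iμ` is surjective for large `μ`. -/
theorem exists_sub_smul (h : IsCommutator A Γ x d) (hΓ : IsSelfAdjointGraph A Γ)
    (hd : Dense (Set.range (addSq Γ 1))) {μ : ℝ} (hμ : 4 * ‖d‖ + 1 ≤ μ) (y : X) :
    ∃ q ∈ mulGraph Γ x, q.2 - (μ * I) • q.1 = y := by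
  -- Replacing x by -x reflects the graph in its first coordinate, which flips the sign of iμ.
  obtain ⟨q, hq, hqy⟩ := h.neg.exists_add_smul hΓ hd (μ := μ) (by rwa [norm_neg]) y
  refine ⟨(-q.1, q.2), ?_, by simpa using hqy⟩
  have hq' : ((-x) q.1, q.2) ∈ Γ := hq
  change (x (-q.1), q.2) ∈ Γ
  simpa using hq'

theorem norm_mulGraph_le' (h : IsCommutator A Γ x d) (hΓ : IsSelfAdjointGraph A Γ)
    (hd : Dense (Set.range (addSq Γ 1))) {μ : ℝ} (hμ : 0 ≤ μ) {q : X × X}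
    (hq : q ∈ mulGraph Γ x) : (μ - ‖d‖) * ‖q.1‖ ≤ ‖q.2 - (μ * I) • q.1‖ := by
  have hq' : (-q.1, q.2) ∈ mulGraph Γ (-x) := by
    have hq' : (x q.1, q.2) ∈ Γ := hq
    change ((-x) (-q.1), q.2) ∈ Γ
    simpa using hq'
  simpa [sub_eq_add_neg] using h.neg.norm_mulGraph_le hΓ hd hμ hq'

/-- `(D x)⋆ + iμ = D x - d + iμ` is surjective for large `μ`. -/
theorem exists_sub_add_smul (h : IsCommutator A Γ x d) (hΓ : IsSelfAdjointGraph A Γ)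
    (hd : Dense (Set.range (addSq Γ 1))) {μ : ℝ} (hμ : 4 * ‖d‖ + 1 ≤ μ) (y : X) :
    ∃ q ∈ mulGraph Γ x, q.2 - d q.1 + (μ * I) • q.1 = y := by
  have hc := norm_nonneg d
  have hc' : 0 < μ - ‖d‖ := by linarith
  let G : mulGraph Γ x →ₗ[ℂ] X :=
    (LinearMap.snd ℂ X X + (μ * I) • LinearMap.fst ℂ X X) ∘ₗ (mulGraph Γ x).subtype
  let H : mulGraph Γ x →ₗ[ℂ] X :=
    (LinearMap.snd ℂ X X - (d : X →ₗ[ℂ] X) ∘ₗ LinearMap.fst ℂ X X +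
      (μ * I) • LinearMap.fst ℂ X X) ∘ₗ (mulGraph Γ x).subtype
  have hG : Function.Surjective G := fun z => by
    obtain ⟨q, hq, hqz⟩ := h.exists_add_smul hΓ hd hμ z
    exact ⟨⟨q, hq⟩, hqz⟩
  have hH : Function.Surjective H := by
    refine surjective_of_norm_sub_le hG (θ := ‖d‖ / (μ - ‖d‖)) ?_ fun q => ?_
    · rw [div_lt_one hc']
      linarith
    · have h1 : H q - G q = -d q.1.1 := by
        simp only [G, H, LinearMap.comp_apply, LinearMap.add_apply, LinearMap.sub_apply,
          ContinuousLinearMap.coe_coe, LinearMap.snd_apply, LinearMap.fst_apply,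
          LinearMap.smul_apply, Submodule.subtype_apply]
        abel
      rw [h1, norm_neg, div_mul_eq_mul_div, mul_div_assoc]
      refine (d.le_opNorm _).trans ?_
      gcongr
      rw [le_div_iff₀' hc']
      exact h.norm_mulGraph_le hΓ hd (by linarith) q.2
  obtain ⟨q, hq⟩ := hH y
  exact ⟨q.1, q.2, hq⟩

/-- `s + (D x)⋆ D x` on its natural domain. -/
def addAdjointMul (Γ : Submodule ℂ (X × X)) (x d : X →L[ℂ] X) (s : ℝ) :
    sqGraph (mulGraph Γ x) →ₗ[ℂ] X :=
  addSq (mulGraph Γ x) s - (d : X →ₗ[ℂ] X) ∘ₗ LinearMap.fst ℂ X X ∘ₗ LinearMap.snd ℂ X (X × X) ∘ₗ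
    (sqGraph (mulGraph Γ x)).subtype

omit [CompleteSpace X] in
theorem addAdjointMul_apply (s : ℝ) (p : sqGraph (mulGraph Γ x)) :
    addAdjointMul Γ x d s p = p.1.2.2 + (s : ℂ) • p.1.1 - d p.1.2.1 := rfl

theorem mul_norm_le_norm_addAdjointMul (h : IsCommutator A Γ x d) (hΓ : IsSelfAdjointGraph A Γ)
    (hd : Dense (Set.range (addSq Γ 1))) {s : ℝ} (hs : 0 ≤ s) (p : sqGraph (mulGraph Γ x)) :
    s * ‖p.1.1‖ ≤ ‖addAdjointMul Γ x d s p‖ := by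
  have h1 := mul_sq_le_norm_smul_add (A := A) hs zero_le_one p.1.1 p.1.2.1
  have h2 : inner A p.1.1 (addAdjointMul Γ x d s p) =
      s • inner A p.1.1 p.1.1 + (1 : ℝ) • inner A p.1.2.1 p.1.2.1 := by
    have h3 := h.inner_mulGraph hΓ hd p.2.1 p.2.2
    simp only [CStarModule.inner_sub_right] at h3
    rw [addAdjointMul_apply, h3]
    simp only [CStarModule.inner_add_right, CStarModule.inner_sub_right,
      CStarModule.inner_smul_right_complex]
    rw [Complex.coe_smul, one_smul]
    abel
  rw [← h2] at h1
  have h4 := h1.trans (CStarModule.norm_inner_le (A := A) X)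
  rcases (norm_nonneg p.1.1).eq_or_lt with h0 | h0
  · rw [← h0]
    simp
  · rw [pow_two, ← mul_assoc, mul_comm] at h4
    exact le_of_mul_le_mul_left h4 h0

theorem surjective_addAdjointMul_sq (h : IsCommutator A Γ x d) (hΓ : IsSelfAdjointGraph A Γ)
    (hd : Dense (Set.range (addSq Γ 1))) {μ : ℝ} (hμ : 8 * ‖d‖ + 1 ≤ μ) :
    Function.Surjective (addAdjointMul Γ x d (μ ^ 2)) := by
  have hc := norm_nonneg d
  -- `(D x - d + iμ) (D x - iμ)`
  let G : sqGraph (mulGraph Γ x) →ₗ[ℂ] X := addAdjointMul Γ x d (μ ^ 2) +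
    (μ * I) • (d : X →ₗ[ℂ] X) ∘ₗ LinearMap.fst ℂ X (X × X) ∘ₗ (sqGraph (mulGraph Γ x)).subtype
  have hGp : ∀ p, G p = p.1.2.2 + ((μ ^ 2 : ℝ) : ℂ) • p.1.1 - d p.1.2.1 + (μ * I) • d p.1.1 :=
    fun p => rfl
  have hG' : ∀ p, G p = (p.1.2.2 - (μ * I) • p.1.2.1) - d (p.1.2.1 - (μ * I) • p.1.1) +
      (μ * I) • (p.1.2.1 - (μ * I) • p.1.1) := by
    intro p
    rw [hGp, map_sub, map_smul]
    push_cast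
    match_scalars
    all_goals first
      | ring1
      | linear_combination (-(μ : ℂ) ^ 2) * I_sq
      | linear_combination ((μ : ℂ) ^ 2) * I_sq
  have hG : Function.Surjective G := by
    intro y
    obtain ⟨w, hw, rfl⟩ := h.exists_sub_add_smul hΓ hd (μ := μ) (by linarith) y
    obtain ⟨q, hq, hqw⟩ := h.exists_sub_smul hΓ hd (μ := μ) (by linarith) w.1
    have h1 : (q.2, w.2 + (μ * I) • q.2) ∈ mulGraph Γ x := by
      have := (mulGraph Γ x).add_mem hw ((mulGraph Γ x).smul_mem (μ * I) hq)
      have h2 : (w.1 + (μ * I) • q.1, w.2 + (μ * I) • q.2) ∈ mulGraph Γ x := this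
      rwa [← hqw, sub_add_cancel] at h2
    refine ⟨⟨(q.1, q.2, w.2 + (μ * I) • q.2), hq, h1⟩, ?_⟩
    rw [hG']
    simp only [hqw, add_sub_cancel_right]
  -- The lower bounds of the two factors multiply; the factor D x - d + iμ loses a further ‖d‖.
  have hlow : ∀ p, (μ - 2 * ‖d‖) * ((μ - ‖d‖) * ‖p.1.1‖) ≤ ‖G p‖ := by
    intro p
    have h1 := h.norm_mulGraph_le' hΓ hd (by linarith : 0 ≤ μ) p.2.1
    have h2 : p.1.2 - (μ * I) • (p.1.1, p.1.2.1) ∈ mulGraph Γ x :=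
      (mulGraph Γ x).sub_mem p.2.2 ((mulGraph Γ x).smul_mem _ p.2.1)
    have h3 := h.norm_mulGraph_le hΓ hd (by linarith : 0 ≤ μ) h2
    simp only [Prod.fst_sub, Prod.snd_sub, Prod.smul_fst, Prod.smul_snd] at h1 h3
    set u := p.1.2.1 - (μ * I) • p.1.1 with hu
    have h4 : p.1.2.2 - (μ * I) • p.1.2.1 + (μ * I) • u = G p + d u := by
      rw [hG']
      abel
    rw [h4] at h3
    have h5 := norm_add_le (G p) (d u)
    have h6 := d.le_opNorm u
    calc (μ - 2 * ‖d‖) * ((μ - ‖d‖) * ‖p.1.1‖) ≤ (μ - 2 * ‖d‖) * ‖u‖ := by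
          gcongr
          linarith
      _ ≤ ‖G p‖ := by linarith
  have hpos : 0 < (μ - 2 * ‖d‖) * (μ - ‖d‖) := mul_pos (by linarith) (by linarith)
  refine surjective_of_norm_sub_le hG (θ := μ * ‖d‖ / ((μ - 2 * ‖d‖) * (μ - ‖d‖))) ?_ fun p => ?_
  · rw [div_lt_one hpos]
    nlinarith
  · have h1 : addAdjointMul Γ x d (μ ^ 2) p - G p = -((μ * I) • d p.1.1) := by
      rw [hGp, addAdjointMul_apply]
      abel
    rw [h1, norm_neg, norm_smul, norm_mul, norm_real, norm_I, mul_one,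
      Real.norm_of_nonneg (by linarith), div_mul_eq_mul_div, mul_div_assoc, mul_assoc]
    refine mul_le_mul_of_nonneg_left ?_ (by linarith)
    refine (d.le_opNorm _).trans ?_
    gcongr
    rw [le_div_iff₀' hpos, mul_assoc]
    exact hlow p

/-- `1 + (D x)⋆ D x` is surjective. -/
theorem surjective_addAdjointMul_one (h : IsCommutator A Γ x d) (hΓ : IsSelfAdjointGraph A Γ)
    (hd : Dense (Set.range (addSq Γ 1))) : Function.Surjective (addAdjointMul Γ x d 1) := by
  set μ := 8 * ‖d‖ + 1 with hμ
  have hμ1 : 1 ≤ μ := by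
    have := norm_nonneg d
    linarith
  have hμ2 : 0 < μ ^ 2 := by positivity
  refine surjective_of_norm_sub_le (h.surjective_addAdjointMul_sq hΓ hd hμ.ge)
    (θ := (μ ^ 2 - 1) / μ ^ 2) (by rw [div_lt_one hμ2]; linarith) fun p => ?_
  have h1 : addAdjointMul Γ x d 1 p - addAdjointMul Γ x d (μ ^ 2) p =
      -(((μ ^ 2 - 1 : ℝ) : ℂ) • p.1.1) := by
    rw [addAdjointMul_apply, addAdjointMul_apply]
    push_cast
    module
  have h2 : 0 ≤ μ ^ 2 - 1 := by nlinarith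
  rw [h1, norm_neg, norm_smul, norm_real, Real.norm_of_nonneg h2, div_mul_eq_mul_div,
    mul_div_assoc]
  refine mul_le_mul_of_nonneg_left ?_ h2
  rw [le_div_iff₀' hμ2]
  exact h.mul_norm_le_norm_addAdjointMul hΓ hd hμ2.le p

end IsCommutator

/-! ### Translation between partial linear maps and graphs -/

theorem mem_graph_adjoint_iff {A X : Type*} [NonUnitalCStarAlgebra A] [PartialOrder A]
    [StarOrderedRing A] [NormedAddCommGroup X] [NormedSpace ℂ X] [SMul A X] [CStarModule A X]
    {T : X →ₗ.[ℂ] X} (hT : Dense (T.domain : Set X)) {q : X × X} :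
    q ∈ (adjoint A T).graph ↔ ∀ p ∈ T.graph, inner A p.2 q.1 = inner A p.1 q.2 := by
  rw [graph_adjoint A hT]
  constructor
  · intro hq p hp
    obtain ⟨ξ, hξ, hξ'⟩ := (LinearPMap.mem_graph_iff T).1 hp
    rw [← hξ, ← hξ']
    exact hq ξ
  · intro hq ξ
    exact hq _ (T.mem_graph ξ)

theorem rangeOneAddAdjointMul_eq {A X : Type*} [NonUnitalCStarAlgebra A] [PartialOrder A]
    [NormedAddCommGroup X] [NormedSpace ℂ X] [SMul A X] [CStarModule A X]
    (T : X →ₗ.[ℂ] X) : rangeOneAddAdjointMul A T =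
      {ζ | ∃ a b c, (a, b) ∈ T.graph ∧ (b, c) ∈ (adjoint A T).graph ∧ a + c = ζ} := by
  ext ζ
  constructor
  · rintro ⟨ξ, h, rfl⟩
    exact ⟨ξ, T ξ, _, T.mem_graph ξ, (adjoint A T).mem_graph ⟨_, h⟩, rfl⟩
  · rintro ⟨a, b, c, hab, hbc, rfl⟩
    obtain ⟨ξ, hξ, hξ'⟩ := (LinearPMap.mem_graph_iff T).1 hab
    obtain ⟨η, hη, hη'⟩ := (LinearPMap.mem_graph_iff _).1 hbc
    simp only at hξ hξ' hη hη'
    subst hξ hξ' hη'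
    refine ⟨ξ, hη ▸ η.2, ?_⟩
    congr 2
    exact Subtype.ext hη.symm

theorem graph_mulBounded {X : Type*} [NormedAddCommGroup X] [NormedSpace ℂ X] (D : X →ₗ.[ℂ] X)
    (x : X →L[ℂ] X) : (mulBounded D x).graph = mulGraph D.graph x := by
  ext q
  change q ∈ (mulBounded D x).graph ↔ (x q.1, q.2) ∈ D.graph
  rw [LinearPMap.mem_graph_iff, LinearPMap.mem_graph_iff]
  constructor
  · rintro ⟨ξ, hξ, hξ'⟩
    refine ⟨⟨x ξ, ξ.2⟩, ?_, hξ'⟩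
    rw [← hξ]
  · rintro ⟨ξ, hξ, hξ'⟩
    have h1 : x q.1 ∈ D.domain := by
      simp only at hξ
      rw [← hξ]
      exact ξ.2
    refine ⟨⟨q.1, h1⟩, rfl, ?_⟩
    rw [← hξ']
    exact congrArg D (Subtype.ext hξ.symm)

theorem mem_graph_sub_toPMap {X : Type*} [NormedAddCommGroup X] [NormedSpace ℂ X]
    {T : X →ₗ.[ℂ] X} {f : X →ₗ[ℂ] X} {q : X × X} :
    q ∈ (T - f.toPMap ⊤).graph ↔ (q.1, q.2 + f q.1) ∈ T.graph := by
  rw [LinearPMap.mem_graph_iff, LinearPMap.mem_graph_iff]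
  constructor
  · rintro ⟨ξ, hξ, hξ'⟩
    refine ⟨⟨ξ, ξ.2.1⟩, hξ, ?_⟩
    replace hξ' : T ⟨ξ, ξ.2.1⟩ - f ξ = q.2 := hξ'
    simp only
    rw [← hξ', ← hξ, sub_add_cancel]
  · rintro ⟨ξ, hξ, hξ'⟩
    refine ⟨⟨ξ, ξ.2, trivial⟩, hξ, ?_⟩
    change T ξ - f ξ = q.2
    simp only at hξ hξ'
    rw [hξ', hξ, add_sub_cancel_right]

theorem IsSelfAdjoint.isSelfAdjointGraph {A X : Type*} [NonUnitalCStarAlgebra A] [PartialOrder A]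
    [StarOrderedRing A] [NormedAddCommGroup X] [NormedSpace ℂ X] [SMul A X] [CStarModule A X]
    {D : X →ₗ.[ℂ] X} (hD : IsSelfAdjoint A D) : IsSelfAdjointGraph A D.graph where
  symm p hp q hq := by
    rw [← hD.adjoint_eq, mem_graph_adjoint_iff hD.dense_domain] at hq
    exact hq p hp
  maximal q hq := by
    rwa [← mem_graph_adjoint_iff hD.dense_domain, hD.adjoint_eq] at hq
  dense := by
    have h : (D.graph.map (LinearMap.fst ℂ X X) : Set X) = D.domain :=
      congrArg SetLike.coe D.graph_map_fst_eq_domain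
    rw [h]
    exact hD.dense_domain

theorem IsRegular.dense_range_addSq {A X : Type*} [NonUnitalCStarAlgebra A] [PartialOrder A]
    [NormedAddCommGroup X] [NormedSpace ℂ X] [SMul A X] [CStarModule A X]
    {D : X →ₗ.[ℂ] X} (hD : IsRegular A D) (hD' : IsSelfAdjoint A D) :
    Dense (Set.range (addSq D.graph 1)) := by
  refine hD.dense_range.mono ?_
  rw [rangeOneAddAdjointMul_eq, hD'.adjoint_eq]
  rintro _ ⟨a, b, c, hab, hbc, rfl⟩
  refine ⟨⟨(a, b, c), hab, hbc⟩, ?_⟩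
  simp [addSq, add_comm]

/-- An operator on a Hilbert C⋆-module that has an adjoint is `A`-linear. -/
theorem map_smul_of_inner_eq {A X : Type*} [NonUnitalCStarAlgebra A] [PartialOrder A]
    [NormedAddCommGroup X] [NormedSpace ℂ X] [SMul A X] [CStarModule A X] {x y : X → X}
    (h : ∀ ξ η, inner A (x ξ) η = inner A ξ (y η)) (a : A) (η : X) : y (a • η) = a • y η := by
  rw [← sub_eq_zero, ← CStarModule.inner_self (A := A)]
  rw [CStarModule.inner_sub_right, CStarModule.inner_op_smul_right, ← h, ← h,
    CStarModule.inner_op_smul_right, sub_self]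

end HilbertModule

/-- Let `X` be a Hilbert C⋆-module over a C⋆-algebra `A`, `D` a selfadjoint regular operator on `X`
and `x` a bounded selfadjoint operator on `X` that preserves the domain of `D` and has a bounded
commutator with `D`. Then `D x`, with the domain `{ξ | x ξ ∈ Dom D}`, is (closed and) regular, and
its adjoint is `D x - δ(x)` on the same domain. -/
theorem propositionp
    {A X : Type*} [NonUnitalCStarAlgebra A] [PartialOrder A] [StarOrderedRing A]
    [NormedAddCommGroup X] [NormedSpace ℂ X] [CompleteSpace X] [SMul A X] [CStarModule A X]
    (D : X →ₗ.[ℂ] X)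
    (hD_sa : HilbertModule.IsSelfAdjoint A D) (hD_reg : HilbertModule.IsRegular A D)
    (x : X →L[ℂ] X) (hx_sa : ∀ ξ η : X, inner A (x ξ) η = inner A ξ (x η))
    (hx : ∀ ξ ∈ D.domain, x ξ ∈ D.domain)
    (hb : ∃ C : ℝ, ∀ ξ : D.domain, ‖HilbertModule.commutator D x hx ξ‖ ≤ C * ‖(ξ : X)‖) :
    HilbertModule.IsRegular A (HilbertModule.mulBounded D x) ∧
      HilbertModule.adjoint A (HilbertModule.mulBounded D x) =
        HilbertModule.mulBounded D x -
          (HilbertModule.commutatorExt D x hx : X →ₗ[ℂ] X).toPMap ⊤ := by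
  open HilbertModule in
  have hΓ := hD_sa.isSelfAdjointGraph
  have hd := hD_reg.dense_range_addSq hD_sa
  set d := commutatorExt D x hx with hd_def
  have h : IsCommutator A D.graph x d := by
    refine ⟨hx_sa, fun p hp => ?_⟩
    obtain ⟨ξ, hξ, hξ'⟩ := (LinearPMap.mem_graph_iff D).1 hp
    rw [← hξ, ← hξ', hd_def, commutatorExt_apply hD_sa.dense_domain hx hb, add_sub_cancel]
    exact D.mem_graph ⟨x ξ, hx ξ ξ.2⟩
  have hdom : D.domain ≤ (mulBounded D x).domain := hx
  have hdense : Dense ((mulBounded D x).domain : Set X) := hD_sa.dense_domain.mono hdom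
  have hadj : adjoint A (mulBounded D x) = mulBounded D x - (d : X →ₗ[ℂ] X).toPMap ⊤ := by
    refine LinearPMap.eq_of_eq_graph (Submodule.ext fun q => ?_)
    rw [mem_graph_adjoint_iff hdense, mem_graph_sub_toPMap, graph_mulBounded]
    refine ⟨fun hq => h.mem_mulGraph_of_inner hΓ hq, fun hq p hp => ?_⟩
    simpa using h.inner_mulGraph hΓ hd hp hq
  refine ⟨⟨?_, ?_, hdense, ?_, ?_⟩, hadj⟩
  · intro a ξ
    have hxa := map_smul_of_inner_eq hx_sa a (ξ : X)
    obtain ⟨h1, h2⟩ := hD_reg.isModuleMap a ⟨x ξ, ξ.2⟩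
    refine ⟨show x (a • (ξ : X)) ∈ D.domain from hxa ▸ h1, ?_⟩
    refine Eq.trans ?_ h2
    exact congrArg D (Subtype.ext hxa)
  · rw [LinearPMap.IsClosed, graph_mulBounded]
    exact IsCommutator.isClosed_mulGraph hΓ x
  · rw [hadj]
    exact hdense.mono fun ξ hξ => ⟨hξ, trivial⟩
  · rw [rangeOneAddAdjointMul_eq]
    convert dense_univ using 1
    refine Set.eq_univ_of_forall fun y => ?_
    obtain ⟨p, hp⟩ := h.surjective_addAdjointMul_one hΓ hd y
    refine ⟨p.1.1, p.1.2.1, p.1.2.2 - d p.1.2.1, ?_, ?_, ?_⟩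
    · rw [graph_mulBounded]
      exact p.2.1
    · rw [hadj, mem_graph_sub_toPMap, graph_mulBounded]
      simpa using p.2.2
    · rw [← hp, IsCommutator.addAdjointMul_apply, Complex.ofReal_one, one_smul]
      abel
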